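/- Let $n\ge 1$ be an integer, $q>n$ and $\sigma>0$ be real numbers, $\langle x\rangle=(1+|x|^2)^{1/2}$ for $x\in\mathbb{R}^n$, and $f(x)=\langle x\rangle^{-q}$. Let $(-\Delta)^\sigma: H^{2\sigma}(\mathbb{R}^n)\to L^2(\mathbb{R}^n)$ be the fractional Laplacian $(-\Delta)^\sigma u=\mathfrak{F}^{-1}(|\xi|^{2\sigma}\,\mathfrak{F}u)$, where $\mathfrak{F}$ is the unitary Fourier transform on $L^2(\mathbb{R}^n)$ with kernel $(2\pi)^{-n/2}e^{-ix\cdot\xi}$. Then $f\in H^{2\sigma}(\mathbb{R}^n)$, and $(-\Delta)^\sigma f$ has a (unique, real-valued) continuous representative, also denoted by $(-\Delta)^\sigma f$. There is a constant $C=C(n,\sigma,q)$ such that $$|(-\Delta)^\sigma f(x)|\le C\,\langle x\rangle^{-q_\sigma}\qquad\text{for all }x\in\mathbb{R}^n,$$ where $q_\sigma=q+2\sigma$ if $\sigma$ is an integer, and $q_\sigma=n+2(\sigma-[\sigma])$ otherwise, $[\sigma]$ being the integer part of $\sigma$. Moreover, every constant $C$ for which this estimate holds satisfies $$C\ \ge\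 (-\Delta)^\sigma f(0)=2^{2\sigma}\,\frac{\Gamma(\sigma+n/2)}{\Gamma(n/2)}\,\frac{\Gamma(\sigma+q/2)}{\Gamma(q/2)}.$$ -/

import Mathlib

open MeasureTheory
open scoped FourierTransform SchwartzMap

/-- The Japanese bracket `⟨x⟩ = (1 + |x|²)^{1/2}` on `ℝⁿ`. -/
noncomputable def japaneseBracket {n : ℕ} (x : EuclideanSpace ℝ (Fin n)) : ℝ :=
  Real.sqrt (1 + ‖x‖ ^ 2)

/-- The complex Hilbert space `L²(ℝⁿ)` (Lebesgue measure). Here `𝓕` and `𝓕⁻` are Mathlib's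
Plancherel extensions of the Fourier transform with kernel `exp (-2πi x·ξ)`, so that the
frequency variable of the kernel `exp (-i x·ξ)` is `2πξ`. -/
abbrev L2Space (n : ℕ) : Type :=
  Lp ℂ 2 (volume : Measure (EuclideanSpace ℝ (Fin n)))

/-- The Sobolev space `H^s(ℝⁿ)`, as a subset of `L²` (for `s ≥ 0`): all `f ∈ L²` such that
`(1 + |ξ|²)^{s/2} f̂` is in `L²`, in the form of Mathlib's `MemSobolev`. -/
def SobolevH (n : ℕ) (s : ℝ) : Set (L2Space n) :=
  {f | TemperedDistribution.MemSobolev s 2 (f : 𝓢'(EuclideanSpace ℝ (Fin n), ℂ))}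

/-- If `f ∈ H^s` with `s ≥ 0`, then `|2πξ|^s f̂` is in `L²`. -/
theorem SobolevH.memLp_symbol_mul {n : ℕ} {s : ℝ} (hs : 0 ≤ s) {f : L2Space n}
    (hf : f ∈ SobolevH n s) :
    MemLp (fun ξ : EuclideanSpace ℝ (Fin n) =>
      (((2 * Real.pi * ‖ξ‖) ^ s : ℝ) : ℂ) * (𝓕 f : L2Space n) ξ) 2 volume := by
  obtain ⟨u, hu⟩ := TemperedDistribution.memSobolev_iff_exists_smulLeftCLM_fourier.mp hf
  rw [Lp.fourier_toTemperedDistribution_eq] at hu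
  set v : EuclideanSpace ℝ (Fin n) → ℂ := fun ξ => (((1 + ‖ξ‖ ^ 2) ^ (-s / 2) : ℝ) : ℂ) with hv
  have hvg : v.HasTemperateGrowth := by rw [hv]; fun_prop
  have hvb : ∀ ξ, ‖v ξ‖ ≤ 1 := fun ξ => by
    rw [hv, Complex.norm_real, Real.norm_of_nonneg (by positivity)]
    exact Real.rpow_le_one_of_one_le_of_nonpos (by nlinarith [sq_nonneg ‖ξ‖]) (by linarith)
  have hvL : MemLp v ⊤ (volume : Measure (EuclideanSpace ℝ (Fin n))) :=
    memLp_top_of_bound hvg.1.continuous.aestronglyMeasurable 1 (Filter.Eventually.of_forall hvb)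
  have key : (hvL.toLp v • u : L2Space n) = 𝓕 f := by
    have hinj : Function.Injective (Lp.toTemperedDistributionCLM ℂ
        (volume : Measure (EuclideanSpace ℝ (Fin n))) 2) :=
      LinearMap.ker_eq_bot.mp Lp.ker_toTemperedDistributionCLM_eq_bot
    apply hinj
    rw [Lp.toTemperedDistributionCLM_apply, Lp.toTemperedDistributionCLM_apply,
      Lp.toTemperedDistribution_smul_eq hvg, ← hu,
      TemperedDistribution.smulLeftCLM_smulLeftCLM_apply (by fun_prop) hvg]
    convert! TemperedDistribution.smulLeftCLM_const 1 _ using 2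
    · congr 1
      ext ξ
      rw [Pi.mul_apply, hv]
      beta_reduce
      norm_cast
      rw [← Real.rpow_add (by positivity)]
      ring_nf
      simp
    · simp
  have hc : Continuous fun ξ : EuclideanSpace ℝ (Fin n) => (2 * Real.pi * ‖ξ‖) ^ s :=
    (by fun_prop : Continuous fun ξ : EuclideanSpace ℝ (Fin n) =>
      2 * Real.pi * ‖ξ‖).rpow_const fun _ => Or.inr hs
  refine (Lp.memLp u).of_le_mul (c := (2 * Real.pi) ^ s)
    ((Complex.continuous_ofReal.comp hc).aestronglyMeasurable.mul (Lp.aestronglyMeasurable _)) ?_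
  rw [← key]
  filter_upwards [Lp.coeFn_lpSMul (r := 2) (hvL.toLp v) u, hvL.coeFn_toLp] with ξ h1 h2
  rw [h1, Pi.smul_apply', h2, smul_eq_mul, ← mul_assoc, norm_mul]
  refine mul_le_mul_of_nonneg_right ?_ (norm_nonneg _)
  rw [hv, norm_mul, Complex.norm_real, Complex.norm_real, Real.norm_of_nonneg (by positivity),
    Real.norm_of_nonneg (by positivity), Real.mul_rpow (by positivity) (norm_nonneg _), mul_assoc]
  refine mul_le_of_le_one_right (by positivity) ?_
  calc ‖ξ‖ ^ s * (1 + ‖ξ‖ ^ 2) ^ (-s / 2)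
      ≤ (1 + ‖ξ‖ ^ 2) ^ (s / 2) * (1 + ‖ξ‖ ^ 2) ^ (-s / 2) := by
        refine mul_le_mul_of_nonneg_right ?_ (by positivity)
        calc ‖ξ‖ ^ s = (‖ξ‖ ^ 2) ^ (s / 2) := by
              rw [← Real.rpow_natCast, ← Real.rpow_mul (norm_nonneg _)]
              congr 1
              push_cast
              ring
          _ ≤ (1 + ‖ξ‖ ^ 2) ^ (s / 2) :=
              Real.rpow_le_rpow (by positivity) (by linarith) (by positivity)
    _ = 1 := by
        rw [← Real.rpow_add (by positivity)]
        ring_nf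
        simp

/-- The fractional Laplacian `(-Δ)^{s/2} : H^s → L²`, `f ↦ 𝓕⁻¹ (|2πξ|^s f̂)`, for `s ≥ 0`. -/
noncomputable def fracLaplacian {n : ℕ} (s : ℝ) (hs : 0 ≤ s) (f : SobolevH n s) : L2Space n :=
  𝓕⁻ ((SobolevH.memLp_symbol_mul hs f.2).toLp _ : L2Space n)

/-- `g : ℝⁿ → ℝ` is the pointwise version of `(-Δ)^σ f`: the function `f` represents an element of
`H^{2σ}`, and `g` is the (unique) continuous representative of the `L²` function `(-Δ)^σ f`. -/
def IsFracLaplacian {n : ℕ} (σ : ℝ) (f g : EuclideanSpace ℝ (Fin n) → ℝ) : Prop :=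
  ∃ (hσ : 0 ≤ 2 * σ) (hf : MemLp (fun x => (f x : ℂ)) 2 volume)
    (hH : hf.toLp (fun x => (f x : ℂ)) ∈ SobolevH n (2 * σ)),
    Continuous g ∧
      (fracLaplacian (2 * σ) hσ ⟨hf.toLp (fun x => (f x : ℂ)), hH⟩ : L2Space n)
        =ᵐ[volume] fun x => (g x : ℂ)

/-- The exponent `q_σ`: it is `q + 2σ` if `σ` is an integer and `n + 2(σ - [σ])` otherwise. -/
noncomputable def decayExponent (n : ℕ) (q σ : ℝ) : ℝ :=
  if σ = (⌊σ⌋ : ℝ) then q + 2 * σ else (n : ℝ) + 2 * (σ - (⌊σ⌋ : ℝ))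

/-!
The proof represents everything by Gaussians. By the Gamma integral, `f(x) = (1 + |x|²)^{-q/2}` is a
superposition of the functions `e^{-t|x|²}` with weight `t^{q/2-1} e^{-t} / Γ(q/2)`, so its Fourier
transform is a superposition of the symbols `e^{-r|2πξ|²}`, `r = 1/(4t)` (`besselSymbol`). It is
bounded because `q > n` and decays rapidly, so `|2πξ|^{2σ} f̂` lies in `L¹ ∩ L²`. Therefore
`f ∈ H^{2σ}`, and the inverse Fourier integral of `|2πξ|^{2σ} f̂` is the continuous representative of
`(-Δ)^σ f` (`isFracLaplacian_japaneseBracket`). By Fubini, it is the superposition of the kernels of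
`(-Δ)^σ e^{rΔ}` with the same weight (`fourierInv_besselSymbol`).

The estimate is thus one for the kernels of `(-Δ)^σ e^{rΔ}` (`fracHeatKernel`). If `σ = k` is an
integer, repeated use of the heat equation shows that the kernel is a Gaussian times a polynomial
(`fracHeatKernel_nat`), and the superposition of Gaussians decays like `⟨x⟩^{-q-2k}`
(`exists_norm_fourierInv_besselSymbol_nat_le`). For general `σ > 0`, choose an integer `k > σ`. Since
`|2πξ|^{2(σ-k)}` is a superposition of the Gaussians `e^{-τ|2πξ|²}`, the kernel of order `σ` is one of
kernels of order `k` (`fracHeatKernel_eq_integral`). This bounds it by a multiple of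
`(r + |y|²)^{-n/2-σ}` (`exists_norm_fracHeatKernel_le`), which survives the superposition in `t`, again
because `q > n`. The resulting decay `⟨x⟩^{-n-2σ}` is at least as strong as required.

At the origin the kernel of `(-Δ)^σ e^{rΔ}` is an explicit multiple of `r^{-n/2-σ}`, and the integral
over `t` is a Gamma integral (`fourierInv_besselSymbol_apply_zero`). Because `⟨0⟩ = 1`, the estimate
at `x = 0` gives the lower bound for the constant.
-/

/-! ### The inverse Fourier transform of integrable functions -/

section Fourier

variable {V : Type*} [NormedAddCommGroup V] [InnerProductSpace ℝ V] [FiniteDimensional ℝ V]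
  [MeasurableSpace V] [BorelSpace V]

theorem continuous_fourier_of_integrable {h : V → ℂ} (h1 : Integrable h) : Continuous (𝓕 h) :=
  VectorFourier.fourierIntegral_continuous Real.continuous_fourierChar
    (by simpa using! continuous_inner) h1

theorem continuous_fourierInv_of_integrable {h : V → ℂ} (h1 : Integrable h) :
    Continuous (𝓕⁻ h) := by
  rw [Real.fourierInv_eq_fourier_comp_neg]
  exact continuous_fourier_of_integrable h1.comp_neg

/-- On `L¹ ∩ L²` the Plancherel extension of the inverse Fourier transform agrees almost everywhere
with the Fourier integral: both define the same tempered distribution. -/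
theorem MeasureTheory.Lp.fourierInv_toLp_ae_eq {h : V → ℂ} (h2 : MemLp h 2) (h1 : Integrable h) :
    (𝓕⁻ (h2.toLp h) : Lp ℂ 2 (volume : Measure V)) =ᵐ[volume] 𝓕⁻ h := by
  apply ae_eq_of_integral_contDiff_smul_eq
  · exact (Lp.memLp _).locallyIntegrable (by norm_num)
  · exact (continuous_fourierInv_of_integrable h1).locallyIntegrable
  intro g g_smooth g_cpt
  have hg₁ : HasCompactSupport (Complex.ofRealCLM ∘ g) := g_cpt.comp_left rfl
  have hg₂ : ContDiff ℝ _ (Complex.ofRealCLM ∘ g) :=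
    Complex.ofRealCLM.contDiff.comp g_smooth
  set φ : 𝓢(V, ℂ) := hg₁.toSchwartzMap hg₂ with hφ
  have hφv : ∀ x, φ x = (g x : ℂ) := fun x => by simp [hφ]
  calc ∫ x, g x • (𝓕⁻ (h2.toLp h) : Lp ℂ 2 (volume : Measure V)) x
      = ∫ x, φ x • (𝓕⁻ (h2.toLp h) : Lp ℂ 2 (volume : Measure V)) x := by simp [hφv]
    _ = (((𝓕⁻ (h2.toLp h) : Lp ℂ 2 (volume : Measure V))) : 𝓢'(V, ℂ)) φ := by
        rw [Lp.toTemperedDistribution_apply]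
    _ = ∫ x, (𝓕⁻ φ) x • (h2.toLp h) x := by
        rw [← Lp.fourierInv_toTemperedDistribution_eq, TemperedDistribution.fourierInv_apply,
          Lp.toTemperedDistribution_apply]
    _ = ∫ x, (𝓕⁻ (φ : V → ℂ)) x • h x := by
        refine integral_congr_ae ?_
        filter_upwards [h2.coeFn_toLp] with x hx
        rw [hx, SchwartzMap.fourierInv_coe]
    _ = ∫ x, φ x • 𝓕⁻ h x := by
        have := VectorFourier.integral_fourierIntegral_smul_eq_flip (L := -innerₗ V)
          (μ := volume) (ν := volume)
          Real.continuous_fourierChar (by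
            change Continuous fun p : V × V => -(inner ℝ p.1 p.2)
            fun_prop) φ.integrable h1
        have e : (-innerₗ V).flip = -innerₗ V := by
          ext x y; simp [real_inner_comm]
        rw [e] at this
        exact this
    _ = _ := by simp [hφv]

/-- Fubini's theorem for the inverse Fourier transform of a superposition of nonnegative
functions. -/
theorem fourierInv_integral_swap {α : Type*} [MeasurableSpace α] {ν : Measure α} [SFinite ν]
    {K : V → α → ℝ} (hK : AEStronglyMeasurable (Function.uncurry K) (volume.prod ν))
    (h0 : ∀ ξ, ∀ᵐ t ∂ν, 0 ≤ K ξ t)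
    (h1 : ∀ᵐ ξ, Integrable (K ξ) ν) (h2 : Integrable fun ξ => ∫ t, K ξ t ∂ν) (x : V) :
    𝓕⁻ (fun ξ => ((∫ t, K ξ t ∂ν : ℝ) : ℂ)) x = ∫ t, 𝓕⁻ (fun ξ => (K ξ t : ℂ)) x ∂ν := by
  have hint : Integrable (Function.uncurry fun ξ t =>
      Complex.exp (((2 * Real.pi * inner ℝ ξ x : ℝ) : ℂ) * Complex.I) • (K ξ t : ℂ))
      (volume.prod ν) := by
    have hb : Integrable (Function.uncurry K) (volume.prod ν) := by
      rw [integrable_prod_iff hK]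
      refine ⟨h1, h2.congr (Filter.Eventually.of_forall fun ξ => ?_)⟩
      refine integral_congr_ae ?_
      filter_upwards [h0 ξ] with t ht
      simp [abs_of_nonneg ht]
    have hc : AEStronglyMeasurable (fun p : V × α =>
        Complex.exp (((2 * Real.pi * inner ℝ p.1 x : ℝ) : ℂ) * Complex.I)) (volume.prod ν) :=
      (Continuous.aestronglyMeasurable (μ := volume) (f := fun ξ : V =>
        Complex.exp (((2 * Real.pi * inner ℝ ξ x : ℝ) : ℂ) * Complex.I)) (by fun_prop)).comp_fst
    refine hb.mono (hc.smul (Complex.continuous_ofReal.comp_aestronglyMeasurable hK))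
      (Filter.Eventually.of_forall fun p => ?_)
    obtain ⟨ξ, t⟩ := p
    simp only [Function.uncurry_apply_pair, norm_smul]
    rw [Complex.norm_exp_ofReal_mul_I, one_mul, Complex.norm_real]
  simp_rw [Real.fourierInv_eq']
  rw [← integral_integral_swap hint]
  congr 1 with ξ
  rw [integral_smul]
  exact congrArg _ integral_ofReal.symm

end Fourier

/-! ### The kernels of `(-Δ)^s e^{rΔ}` -/

section Heat

theorem exists_one_add_rpow_le_exp (s : ℝ) {c : ℝ} (hc : 0 < c) :
    ∃ C : ℝ, 0 < C ∧ ∀ z : ℝ, 0 ≤ z → (1 + z) ^ s ≤ C * Real.exp (c * z) := by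
  set m := ⌈s⌉₊
  refine ⟨c⁻¹ ^ m * m.factorial * Real.exp c, by positivity, fun z hz => ?_⟩
  have h1 : (1 + z) ^ s ≤ (1 + z) ^ m := by
    rw [← Real.rpow_natCast]
    exact Real.rpow_le_rpow_of_exponent_le (by linarith) (Nat.le_ceil s)
  have h2 := Real.pow_div_factorial_le_exp (c * (1 + z)) (by positivity) m
  rw [div_le_iff₀ (by positivity), mul_pow] at h2
  calc (1 + z) ^ s ≤ (1 + z) ^ m := h1
    _ = c⁻¹ ^ m * (c ^ m * (1 + z) ^ m) := by
        rw [← mul_assoc, ← mul_pow, inv_mul_cancel₀ hc.ne', one_pow, one_mul]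
    _ ≤ c⁻¹ ^ m * (Real.exp (c * (1 + z)) * m.factorial) := by gcongr
    _ = _ := by rw [mul_add, Real.exp_add, mul_one]; ring

theorem exists_rpow_le_exp {s : ℝ} (hs : 0 ≤ s) {c : ℝ} (hc : 0 < c) :
    ∃ C : ℝ, 0 < C ∧ ∀ z : ℝ, 0 ≤ z → z ^ s ≤ C * Real.exp (c * z) := by
  obtain ⟨C, hC, h⟩ := exists_one_add_rpow_le_exp s hc
  exact ⟨C, hC, fun z hz => (Real.rpow_le_rpow hz (by linarith) hs).trans (h z hz)⟩

theorem Polynomial.exists_abs_eval_le_exp (P : Polynomial ℝ) {c : ℝ} (hc : 0 < c) :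
    ∃ C : ℝ, 0 < C ∧ ∀ z : ℝ, 0 ≤ z → |P.eval z| ≤ C * Real.exp (c * z) := by
  induction P using Polynomial.induction_on' with
  | add P Q hP hQ =>
    obtain ⟨C, hC, h⟩ := hP
    obtain ⟨D, hD, h'⟩ := hQ
    refine ⟨C + D, by positivity, fun z hz => ?_⟩
    rw [Polynomial.eval_add, add_mul]
    exact (abs_add_le _ _).trans (add_le_add (h z hz) (h' z hz))
  | monomial m a =>
    obtain ⟨C, hC, h⟩ := exists_rpow_le_exp (Nat.cast_nonneg m) hc
    refine ⟨(|a| + 1) * C, by positivity, fun z hz => ?_⟩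
    rw [Polynomial.eval_monomial, abs_mul, abs_of_nonneg (pow_nonneg hz m), ← Real.rpow_natCast,
      mul_assoc]
    exact mul_le_mul (by linarith) (h z hz) (by positivity) (by positivity)

variable {V : Type*} [NormedAddCommGroup V] [InnerProductSpace ℝ V] [FiniteDimensional ℝ V]
  [MeasurableSpace V] [BorelSpace V]

/-- The Fourier symbol `|2πξ|^{2s} exp (-r |2πξ|²)` of `(-Δ)^s e^{rΔ}`. -/
noncomputable def fracHeatSymbol {V : Type*} [NormedAddCommGroup V] (s r : ℝ) (ξ : V) : ℝ :=
  (2 * Real.pi * ‖ξ‖) ^ (2 * s) * Real.exp (-(r * (2 * Real.pi * ‖ξ‖) ^ 2))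

/-- The kernel of `(-Δ)^s e^{rΔ}`. -/
noncomputable def fracHeatKernel (s r : ℝ) (y : V) : ℂ :=
  𝓕⁻ (fun ξ : V => (fracHeatSymbol s r ξ : ℂ)) y

theorem fracHeatSymbol_nonneg {V : Type*} [NormedAddCommGroup V] (s r : ℝ) (ξ : V) :
    0 ≤ fracHeatSymbol s r ξ := by
  unfold fracHeatSymbol; positivity

theorem continuous_fracHeatSymbol {V : Type*} [NormedAddCommGroup V] {s : ℝ} (hs : 0 ≤ s) (r : ℝ) :
    Continuous (fracHeatSymbol s r : V → ℝ) := by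
  unfold fracHeatSymbol
  exact ((by fun_prop : Continuous fun ξ : V => 2 * Real.pi * ‖ξ‖).rpow_const
    fun _ => Or.inr (by positivity)).mul (by fun_prop)

theorem integrable_exp_neg_mul_sq_norm {b : ℝ} (hb : 0 < b) :
    Integrable fun ξ : V => Real.exp (-(b * ‖ξ‖ ^ 2)) := by
  have := (GaussianFourier.integrable_cexp_neg_mul_sq_norm_add (V := V) (b := (b : ℂ))
    (by simpa using hb) 0 0).norm
  refine this.congr (Filter.Eventually.of_forall fun ξ => ?_)
  simp only [zero_mul, add_zero, Complex.norm_exp]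
  congr 1
  norm_cast
  simp

theorem integrable_fracHeatSymbol {s r : ℝ} (hs : 0 ≤ s) (hr : 0 < r) :
    Integrable (fracHeatSymbol s r : V → ℝ) := by
  obtain ⟨C, hC, h⟩ := exists_rpow_le_exp hs (half_pos hr)
  refine ((integrable_exp_neg_mul_sq_norm (V := V) (b := r / 2 * (2 * Real.pi) ^ 2)
    (by positivity)).const_mul C).mono'
    (continuous_fracHeatSymbol hs r).aestronglyMeasurable (Filter.Eventually.of_forall fun ξ => ?_)
  rw [Real.norm_of_nonneg (fracHeatSymbol_nonneg s r ξ), fracHeatSymbol,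
    Real.rpow_mul (by positivity), Real.rpow_two]
  refine (mul_le_mul_of_nonneg_right (h _ (by positivity)) (Real.exp_nonneg _)).trans (le_of_eq ?_)
  rw [mul_assoc, ← Real.exp_add]
  ring_nf

/-- The heat equation `∂_r (-Δ)^s e^{rΔ} = -(-Δ)^{s+1} e^{rΔ}` for the kernels. -/
theorem hasDerivAt_fracHeatKernel {s r : ℝ} (hs : 0 ≤ s) (hr : 0 < r) (y : V) :
    HasDerivAt (fun r => fracHeatKernel s r y) (-fracHeatKernel (s + 1) r y) r := by
  have key : ∀ (ξ : V) (x : ℝ), HasDerivAt (fun x => fracHeatSymbol s x ξ)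
      (-fracHeatSymbol (s + 1) x ξ) x := fun ξ x => by
    have h1 : HasDerivAt (fun x : ℝ => -(x * (2 * Real.pi * ‖ξ‖) ^ 2))
        (-(1 * (2 * Real.pi * ‖ξ‖) ^ 2)) x := ((hasDerivAt_id x).mul_const _).neg
    have h2 := h1.exp.const_mul ((2 * Real.pi * ‖ξ‖) ^ (2 * s))
    convert! h2 using 1
    rw [fracHeatSymbol, mul_add, mul_one, Real.rpow_add_of_nonneg (by positivity) (by positivity)
      (by positivity), Real.rpow_two]
    ring
  have main := hasDerivAt_integral_of_dominated_loc_of_deriv_le (μ := (volume : Measure V))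
    (s := Set.Ioi (r / 2)) (x₀ := r)
    (F := fun x ξ => Complex.exp (((2 * Real.pi * inner ℝ ξ y : ℝ) : ℂ) * Complex.I) •
      (fracHeatSymbol s x ξ : ℂ))
    (F' := fun x ξ => Complex.exp (((2 * Real.pi * inner ℝ ξ y : ℝ) : ℂ) * Complex.I) •
      (-fracHeatSymbol (s + 1) x ξ : ℂ))
    (bound := fracHeatSymbol (s + 1) (r / 2))
    (Ioi_mem_nhds (by linarith)) ?_ ?_ ?_ ?_
    (integrable_fracHeatSymbol (by linarith) (by positivity)) ?_
  · have := main.2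
    simp only [smul_neg, integral_neg] at this
    simpa only [fracHeatKernel, Real.fourierInv_eq'] using this
  · refine Filter.Eventually.of_forall fun x => Continuous.aestronglyMeasurable ?_
    have := continuous_fracHeatSymbol (V := V) hs x
    fun_prop
  · refine (integrable_fracHeatSymbol (V := V) hs hr).mono
      (Continuous.aestronglyMeasurable ?_) (Filter.Eventually.of_forall fun ξ => ?_)
    · have := continuous_fracHeatSymbol (V := V) hs r
      fun_prop
    · rw [norm_smul, Complex.norm_exp_ofReal_mul_I, one_mul, Complex.norm_real]
  · refine Continuous.aestronglyMeasurable ?_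
    have := continuous_fracHeatSymbol (V := V) (by linarith : 0 ≤ s + 1) r
    fun_prop
  · refine Filter.Eventually.of_forall fun ξ x hx => ?_
    rw [norm_smul, Complex.norm_exp_ofReal_mul_I, one_mul, norm_neg, Complex.norm_real,
      Real.norm_of_nonneg (fracHeatSymbol_nonneg _ _ _)]
    unfold fracHeatSymbol
    have : r / 2 ≤ x := le_of_lt hx
    gcongr
  · refine Filter.Eventually.of_forall fun ξ x _ => ?_
    have := ((key ξ x).ofReal_comp).const_smul
      (Complex.exp (((2 * Real.pi * inner ℝ ξ y : ℝ) : ℂ) * Complex.I))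
    simpa using! this

theorem fracHeatKernel_zero {r : ℝ} (hr : 0 < r) (y : V) :
    fracHeatKernel 0 r y = (((4 * Real.pi) ^ (-(Module.finrank ℝ V / 2 : ℝ)) *
      (r ^ (-(Module.finrank ℝ V / 2 : ℝ)) * Real.exp (-(‖y‖ ^ 2 / r) / 4)) : ℝ) : ℂ) := by
  have hpi := Real.pi_pos
  have hb : 0 < ((r * (2 * Real.pi) ^ 2 : ℝ) : ℂ).re := by
    rw [Complex.ofReal_re]; positivity
  have := fourier_gaussian_innerProductSpace hb (-y)
  rw [← Real.fourierInv_eq_fourier_neg] at this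
  have e : (fun ξ : V => (fracHeatSymbol 0 r ξ : ℂ)) =
      fun v => Complex.exp (-((r * (2 * Real.pi) ^ 2 : ℝ) : ℂ) * ‖v‖ ^ 2) := by
    ext ξ
    simp only [fracHeatSymbol, mul_zero, Real.rpow_zero, one_mul]
    push_cast
    ring_nf
  rw [fracHeatKernel, e, this, norm_neg]
  have e2 : (Real.pi / ((r * (2 * Real.pi) ^ 2 : ℝ) : ℂ)) = (((4 * Real.pi * r)⁻¹ : ℝ) : ℂ) := by
    push_cast
    have : (Real.pi : ℂ) ≠ 0 := by exact_mod_cast hpi.ne'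
    have : (r : ℂ) ≠ 0 := by exact_mod_cast hr.ne'
    field_simp
    norm_num
  have e3 : ((Module.finrank ℝ V : ℂ) / 2) = ((Module.finrank ℝ V / 2 : ℝ) : ℂ) := by push_cast; rfl
  rw [e2, e3, ← Complex.ofReal_cpow (by positivity), Real.inv_rpow (by positivity),
    ← Real.rpow_neg (by positivity), Real.mul_rpow (by positivity) hr.le]
  rw [← mul_assoc]
  push_cast
  congr 2
  have : (Real.pi : ℂ) ≠ 0 := by exact_mod_cast hpi.ne'
  have : (r : ℂ) ≠ 0 := by exact_mod_cast hr.ne'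
  field_simp
  norm_num

/-- For integer order the kernel is a polynomial in `|y|²/r` times the heat kernel `e^{-|y|²/(4r)}`.
The heat equation turns the polynomial `P` for `k` into `p P + z P' - z P / 4` for `k + 1`, where
`p = d/2 + k`. -/
theorem fracHeatKernel_nat (k : ℕ) : ∃ P : Polynomial ℝ, ∀ (r : ℝ), 0 < r → ∀ y : V,
    fracHeatKernel k r y = ((r ^ (-(Module.finrank ℝ V / 2 + k : ℝ)) *
      P.eval (‖y‖ ^ 2 / r) * Real.exp (-(‖y‖ ^ 2 / r) / 4) : ℝ) : ℂ) := by
  induction k with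
  | zero =>
    refine ⟨Polynomial.C ((4 * Real.pi) ^ (-(Module.finrank ℝ V / 2 : ℝ))), fun r hr y => ?_⟩
    rw [Nat.cast_zero, fracHeatKernel_zero hr, Polynomial.eval_C, add_zero]
    congr 1
    ring
  | succ k ih =>
    obtain ⟨P, hP⟩ := ih
    set p : ℝ := Module.finrank ℝ V / 2 + k with hp
    refine ⟨Polynomial.C p * P + Polynomial.X * P.derivative
      - Polynomial.C (1 / 4) * Polynomial.X * P, fun r hr y => ?_⟩
    have h1 := hasDerivAt_fracHeatKernel (Nat.cast_nonneg k) hr y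
    have hz : HasDerivAt (fun r : ℝ => ‖y‖ ^ 2 / r) (-(‖y‖ ^ 2 / r ^ 2)) r := by
      have := (hasDerivAt_inv hr.ne').const_mul (‖y‖ ^ 2)
      convert! this using 1
      rw [div_eq_mul_inv]; ring
    have h2 := ((((hasDerivAt_id r).rpow_const (p := -p) (Or.inl hr.ne')).mul
      ((P.hasDerivAt _).comp r hz)).mul (hz.neg.div_const 4).exp).ofReal_comp
    have h3 := h1.unique (h2.congr_of_eventuallyEq (by
      filter_upwards [Ioi_mem_nhds hr] with x hx
      rw [hP x hx y]
      rfl))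
    rw [Nat.cast_succ, ← neg_neg (fracHeatKernel _ _ _), h3, ← Complex.ofReal_neg]
    congr 1
    have e1 : r ^ (-p) = r ^ (-(Module.finrank ℝ V / 2 + ((k : ℝ) + 1))) * r := by
      rw [← Real.rpow_add_one hr.ne']
      congr 1
      rw [hp]; ring
    have e2 : r ^ (-p - 1) = r ^ (-(Module.finrank ℝ V / 2 + ((k : ℝ) + 1))) := by
      congr 1
      rw [hp]; ring
    simp only [id, Polynomial.eval_add, Polynomial.eval_sub, Polynomial.eval_mul,
      Polynomial.eval_C, Polynomial.eval_X, Function.comp, Pi.mul_apply, Pi.neg_apply, e1, e2]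
    generalize r ^ (-(Module.finrank ℝ V / 2 + ((k : ℝ) + 1))) = w
    field_simp
    ring_nf

/-- Half of the Gaussian factor `e^{-|y|²/(4r)}` absorbs the polynomial. -/
theorem exists_norm_fracHeatKernel_nat_le (k : ℕ) : ∃ C : ℝ, 0 < C ∧ ∀ r : ℝ, 0 < r → ∀ y : V,
    ‖fracHeatKernel k r y‖ ≤ C * r ^ (-(Module.finrank ℝ V / 2 + k : ℝ)) *
      Real.exp (-(‖y‖ ^ 2 / r) / 8) := by
  obtain ⟨P, hP⟩ := fracHeatKernel_nat (V := V) k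
  obtain ⟨C, hC, h⟩ := P.exists_abs_eval_le_exp (c := 1 / 8) (by norm_num)
  refine ⟨C, hC, fun r hr y => ?_⟩
  rw [hP r hr y, Complex.norm_real, Real.norm_eq_abs, abs_mul, abs_mul, Real.abs_exp,
    abs_of_nonneg (by positivity : 0 ≤ r ^ (-(Module.finrank ℝ V / 2 + k : ℝ)))]
  calc _ ≤ r ^ (-(Module.finrank ℝ V / 2 + k : ℝ)) * (C * Real.exp (1 / 8 * (‖y‖ ^ 2 / r))) *
        Real.exp (-(‖y‖ ^ 2 / r) / 4) := by
        gcongr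
        exact h _ (by positivity)
    _ = C * r ^ (-(Module.finrank ℝ V / 2 + k : ℝ)) * (Real.exp (1 / 8 * (‖y‖ ^ 2 / r)) *
        Real.exp (-(‖y‖ ^ 2 / r) / 4)) := by ring
    _ = _ := by
        rw [← Real.exp_add]
        ring_nf

end Heat

/-! ### Kernels of fractional order as superpositions of kernels of integer order -/

section Subordination

open Set Real

theorem integrableOn_rpow_mul_add_one_rpow {a N : ℝ} (ha : 0 < a) (hN : a < N) :
    IntegrableOn (fun v : ℝ => v ^ (a - 1) * (v + 1) ^ (-N)) (Ioi 0) := by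
  have hm : ∀ s ⊆ Ioi (0 : ℝ), MeasurableSet s → AEStronglyMeasurable
      (fun v : ℝ => v ^ (a - 1) * (v + 1) ^ (-N)) (volume.restrict s) := fun s _ _ => by
    exact Measurable.aestronglyMeasurable (by fun_prop)
  rw [← Ioc_union_Ioi_eq_Ioi zero_le_one]
  refine IntegrableOn.union ?_ ?_
  · have h1 : IntegrableOn (fun v : ℝ => v ^ (a - 1)) (Ioc 0 1) :=
      (intervalIntegrable_iff_integrableOn_Ioc_of_le zero_le_one).mp
        (intervalIntegral.intervalIntegrable_rpow' (by linarith))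
    refine Integrable.mono' h1 (hm _ Ioc_subset_Ioi_self measurableSet_Ioc) ?_
    filter_upwards [ae_restrict_mem measurableSet_Ioc] with v hv
    have hv0 : 0 < v := hv.1
    rw [norm_of_nonneg (by positivity)]
    exact mul_le_of_le_one_right (by positivity)
      (rpow_le_one_of_one_le_of_nonpos (by linarith) (by linarith))
  · have h1 : IntegrableOn (fun v : ℝ => v ^ (a - 1 - N)) (Ioi 1) :=
      integrableOn_Ioi_rpow_of_lt (by linarith) zero_lt_one
    refine Integrable.mono' h1 (hm _ (Ioi_subset_Ioi zero_le_one) measurableSet_Ioi) ?_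
    filter_upwards [ae_restrict_mem measurableSet_Ioi] with v hv
    have hv0 : 0 < v := zero_lt_one.trans hv
    rw [norm_of_nonneg (by positivity), sub_eq_add_neg (a - 1), rpow_add hv0]
    exact mul_le_mul_of_nonneg_left
      (rpow_le_rpow_of_nonpos hv0 (by linarith) (by linarith)) (by positivity)

theorem rpow_mul_add_rpow_scale {a N B v : ℝ} (hB : 0 < B) (hv : 0 < v) :
    (B * v) ^ (a - 1) * (B * v + B) ^ (-N) =
      B ^ (a - 1 - N) * (v ^ (a - 1) * (v + 1) ^ (-N)) := by
  rw [← mul_add_one, mul_rpow hB.le hv.le, mul_rpow hB.le (by positivity),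
    sub_eq_add_neg (a - 1), rpow_add hB]
  ring

theorem integrableOn_rpow_mul_add_rpow {a N B : ℝ} (ha : 0 < a) (hN : a < N) (hB : 0 < B) :
    IntegrableOn (fun v : ℝ => v ^ (a - 1) * (v + B) ^ (-N)) (Ioi 0) := by
  have := integrableOn_Ioi_comp_mul_left_iff (fun v : ℝ => v ^ (a - 1) * (v + B) ^ (-N)) 0 hB
  rw [mul_zero] at this
  rw [← this]
  refine IntegrableOn.congr_fun ((integrableOn_rpow_mul_add_one_rpow ha hN).const_mul
    (B ^ (a - 1 - N))) (fun v hv => ?_) measurableSet_Ioi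
  exact (rpow_mul_add_rpow_scale hB hv).symm

/-- The right-hand integral is a Beta function; only its finiteness matters. -/
theorem integral_rpow_mul_add_rpow (a N : ℝ) {B : ℝ} (hB : 0 < B) :
    ∫ v in Ioi (0 : ℝ), v ^ (a - 1) * (v + B) ^ (-N) =
      B ^ (a - N) * ∫ v in Ioi (0 : ℝ), v ^ (a - 1) * (v + 1) ^ (-N) := by
  have := integral_comp_mul_left_Ioi (fun v : ℝ => v ^ (a - 1) * (v + B) ^ (-N)) 0 hB
  rw [mul_zero, setIntegral_congr_fun measurableSet_Ioi
    (fun v hv => rpow_mul_add_rpow_scale hB hv), integral_const_mul, smul_eq_mul] at this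
  rw [← mul_inv_cancel_left₀ hB.ne' (∫ v in Ioi (0 : ℝ), v ^ (a - 1) * (v + B) ^ (-N)),
    ← this, show a - 1 - N = a - N - 1 by ring, rpow_sub_one hB.ne']
  field_simp

variable {V : Type*} [NormedAddCommGroup V] [InnerProductSpace ℝ V] [FiniteDimensional ℝ V]
  [MeasurableSpace V] [BorelSpace V]

theorem integrableOn_rpow_mul_exp_neg_mul {a b : ℝ} (ha : 0 < a) (hb : 0 < b) :
    IntegrableOn (fun t : ℝ => t ^ (a - 1) * exp (-(b * t))) (Ioi 0) := by
  by_contra h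
  have h1 := integral_undef h
  rw [integral_rpow_mul_exp_neg_mul_Ioi ha hb] at h1
  have h2 := Gamma_pos_of_pos ha
  exact absurd h1 (by positivity)

theorem fourierInv_const_mul_ofReal (c : ℝ) (S : V → ℝ) (x : V) :
    𝓕⁻ (fun ξ => ((c * S ξ : ℝ) : ℂ)) x = c * 𝓕⁻ (fun ξ => (S ξ : ℂ)) x := by
  simp only [Real.fourierInv_eq', smul_eq_mul, ← integral_const_mul]
  congr 1 with ξ
  push_cast
  ring

/-- Subordination: `|2πξ|^{2s} = Γ(k-s)⁻¹ |2πξ|^{2k} ∫₀^∞ τ^{k-s-1} e^{-τ|2πξ|²} dτ` for `k > s`, so the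
kernel of order `s` is a superposition of kernels of order `k` at later times. -/
theorem fracHeatKernel_eq_integral {s k : ℝ} (hs : 0 < s) (hk : s < k) {r : ℝ} (hr : 0 < r)
    (y : V) : fracHeatKernel s r y = ∫ τ in Ioi (0 : ℝ),
      ((τ ^ (k - s - 1) / Gamma (k - s) : ℝ) : ℂ) * fracHeatKernel k (r + τ) y := by
  have ha : 0 < k - s := by linarith
  have hG := Gamma_pos_of_pos ha
  set K : V → ℝ → ℝ := fun ξ τ => τ ^ (k - s - 1) / Gamma (k - s) * fracHeatSymbol k (r + τ) ξ
    with hK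
  have hK' : ∀ ξ τ, K ξ τ = fracHeatSymbol k r ξ / Gamma (k - s) *
      (τ ^ (k - s - 1) * exp (-((2 * π * ‖ξ‖) ^ 2 * τ))) := fun ξ τ => by
    have e : -((r + τ) * (2 * π * ‖ξ‖) ^ 2) =
      -(r * (2 * π * ‖ξ‖) ^ 2) + -((2 * π * ‖ξ‖) ^ 2 * τ) := by ring
    rw [hK]
    simp only [fracHeatSymbol]
    rw [e, exp_add]
    ring
  -- at `ξ = 0` the Gamma integral diverges, but both symbols vanish there
  have hz : ∀ t : ℝ, 0 < t → ∀ u, fracHeatSymbol t u (0 : V) = 0 := fun t ht u => by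
    rw [fracHeatSymbol, norm_zero, mul_zero, zero_rpow (by positivity), zero_mul]
  have hA : ∀ ξ : V, ξ ≠ 0 → 0 < (2 * π * ‖ξ‖) := fun ξ hξ => by
    have := norm_pos_iff.mpr hξ
    positivity
  have hI : ∀ ξ, ∫ τ in Ioi (0 : ℝ), K ξ τ = fracHeatSymbol s r ξ := fun ξ => by
    rcases eq_or_ne ξ 0 with rfl | hξ
    · simp [hK', hz k (hs.trans hk), hz s hs]
    · simp_rw [hK', integral_const_mul]
      rw [integral_rpow_mul_exp_neg_mul_Ioi ha (by have := hA ξ hξ; positivity)]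
      have e : (1 / (2 * π * ‖ξ‖) ^ 2) ^ (k - s) = (2 * π * ‖ξ‖) ^ (2 * s - 2 * k) := by
        rw [one_div, ← rpow_natCast, ← rpow_neg (hA ξ hξ).le, ← rpow_mul (hA ξ hξ).le]
        congr 1
        push_cast
        ring
      rw [e, div_mul_eq_mul_div, mul_div_assoc, mul_div_cancel_right₀ _ hG.ne', fracHeatSymbol,
        fracHeatSymbol, rpow_sub (hA ξ hξ)]
      have := rpow_pos_of_pos (hA ξ hξ) (2 * k)
      field_simp
  have main := fourierInv_integral_swap (ν := volume.restrict (Ioi (0 : ℝ))) (K := K) ?_ ?_ ?_ ?_ y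
  · simp_rw [hI] at main
    rw [fracHeatKernel, main]
    simp_rw [hK, fourierInv_const_mul_ofReal]
    rfl
  · refine Measurable.aestronglyMeasurable ?_
    simp only [hK, fracHeatSymbol, Function.uncurry_def]
    fun_prop
  · intro ξ
    filter_upwards [ae_restrict_mem measurableSet_Ioi] with τ (hτ : 0 < τ)
    have := fracHeatSymbol_nonneg k (r + τ) ξ
    rw [hK]
    positivity
  · refine Filter.Eventually.of_forall fun ξ => ?_
    rcases eq_or_ne ξ 0 with rfl | hξ
    · have : K 0 = 0 := by ext τ; simp [hK', hz k (hs.trans hk)]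
      rw [this]
      exact integrable_zero _ _ _
    · rw [funext (hK' ξ)]
      have := hA ξ hξ
      exact (integrableOn_rpow_mul_exp_neg_mul ha (by positivity)).const_mul _
  · simp_rw [hI]
    exact integrable_fracHeatSymbol hs.le hr

/-- The kernel of fractional order decays like `|y|^{-d-2s}`. For an integer `k > s` the kernel of
order `k` at time `ρ` is `O((ρ + |y|²)^{-d/2-k})`, and subordination integrates this bound over
`ρ = r + τ` against `τ^{k-s-1} dτ`. -/
theorem exists_norm_fracHeatKernel_le {s : ℝ} (hs : 0 < s) : ∃ C : ℝ, 0 < C ∧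
    ∀ r : ℝ, 0 < r → ∀ y : V,
      ‖fracHeatKernel s r y‖ ≤ C * (r + ‖y‖ ^ 2) ^ (-(Module.finrank ℝ V / 2 + s : ℝ)) := by
  obtain ⟨k, hk⟩ := exists_nat_gt s
  have ha : 0 < (k : ℝ) - s := by linarith
  have hG := Gamma_pos_of_pos ha
  set N : ℝ := Module.finrank ℝ V / 2 + k with hN
  have hN0 : 0 ≤ (Module.finrank ℝ V / 2 : ℝ) := by positivity
  have haN : k - s < N := by linarith
  obtain ⟨C, hC, h⟩ := exists_norm_fracHeatKernel_nat_le (V := V) k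
  obtain ⟨D, hD, h'⟩ := exists_one_add_rpow_le_exp N (c := 1 / 8) (by norm_num)
  set I := ∫ v in Ioi (0 : ℝ), v ^ (k - s - 1) * (v + 1) ^ (-N) with hI
  have hI0 : 0 ≤ I := setIntegral_nonneg measurableSet_Ioi fun v (hv : 0 < v) => by positivity
  refine ⟨C * D / Gamma (k - s) * (I + 1), by positivity, fun r hr y => ?_⟩
  have hB : 0 < r + ‖y‖ ^ 2 := by positivity
  have hbd : ∀ ρ : ℝ, 0 < ρ → ‖fracHeatKernel k ρ y‖ ≤ C * D * (ρ + ‖y‖ ^ 2) ^ (-N) := by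
    intro ρ hρ
    refine (h ρ hρ y).trans ?_
    have h1 := h' (‖y‖ ^ 2 / ρ) (by positivity)
    -- `ρ^{-N} (1 + |y|²/ρ)^{-N} = (ρ + |y|²)^{-N}` for the exponent `N = d/2 + k` of `ρ`
    have h2 : exp (-(‖y‖ ^ 2 / ρ) / 8) ≤ D * (1 + ‖y‖ ^ 2 / ρ) ^ (-N) := by
      rw [rpow_neg (by positivity), ← div_eq_mul_inv, le_div_iff₀ (by positivity)]
      calc _ ≤ exp (-(‖y‖ ^ 2 / ρ) / 8) * (D * exp (1 / 8 * (‖y‖ ^ 2 / ρ))) := by gcongr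
        _ = D * exp (-(‖y‖ ^ 2 / ρ) / 8 + 1 / 8 * (‖y‖ ^ 2 / ρ)) := by rw [exp_add]; ring
        _ = D := by ring_nf; simp
    calc C * ρ ^ (-N) * exp (-(‖y‖ ^ 2 / ρ) / 8)
        ≤ C * ρ ^ (-N) * (D * (1 + ‖y‖ ^ 2 / ρ) ^ (-N)) := by gcongr
      _ = C * D * (ρ ^ (-N) * (1 + ‖y‖ ^ 2 / ρ) ^ (-N)) := by ring
      _ = _ := by
        rw [← mul_rpow hρ.le (by positivity), mul_add, mul_one, mul_div_cancel₀ _ hρ.ne']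
  rw [fracHeatKernel_eq_integral hs hk hr y]
  calc _ ≤ ∫ τ in Ioi (0 : ℝ), C * D / Gamma (k - s) *
        (τ ^ (k - s - 1) * (τ + (r + ‖y‖ ^ 2)) ^ (-N)) := by
        refine norm_integral_le_of_norm_le
          ((integrableOn_rpow_mul_add_rpow ha haN hB).const_mul _) ?_
        filter_upwards [ae_restrict_mem measurableSet_Ioi] with τ (hτ : 0 < τ)
        rw [norm_mul, Complex.norm_real, norm_of_nonneg (by positivity)]
        calc _ ≤ τ ^ (k - s - 1) / Gamma (k - s) * (C * D * (r + τ + ‖y‖ ^ 2) ^ (-N)) := by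
              gcongr
              exact hbd _ (by positivity)
          _ = _ := by ring_nf
    _ = C * D / Gamma (k - s) * I * (r + ‖y‖ ^ 2) ^ (-(Module.finrank ℝ V / 2 + s : ℝ)) := by
        rw [integral_const_mul, integral_rpow_mul_add_rpow _ _ hB, ← hI,
          show (k - s - N : ℝ) = -(Module.finrank ℝ V / 2 + s : ℝ) by rw [hN]; ring]
        ring
    _ ≤ _ := by
        gcongr
        linarith

/-- The value at the origin is the integral of the symbol, computed in polar coordinates. -/
theorem fracHeatKernel_apply_zero [Nontrivial V] {s r : ℝ} (hs : 0 ≤ s) (hr : 0 < r) :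
    fracHeatKernel s r (0 : V) = (((4 * π) ^ (-(Module.finrank ℝ V / 2 : ℝ)) *
      (Gamma (s + Module.finrank ℝ V / 2) / Gamma (Module.finrank ℝ V / 2)) *
      r ^ (-(Module.finrank ℝ V / 2 + s : ℝ)) : ℝ) : ℂ) := by
  set d := Module.finrank ℝ V with hd
  have hd0 : 0 < d := Module.finrank_pos
  have hdr : (0 : ℝ) < d := by exact_mod_cast hd0
  have hpi := pi_pos
  have e1 : fracHeatKernel s r (0 : V) = ((∫ ξ : V, fracHeatSymbol s r ξ : ℝ) : ℂ) := by
    rw [fracHeatKernel, Real.fourierInv_eq']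
    simp only [inner_zero_right, mul_zero, Complex.ofReal_zero, zero_mul, Complex.exp_zero,
      one_smul]
    exact integral_ofReal
  rw [e1]
  congr 1
  have := integral_fun_norm_addHaar (volume : Measure V)
    (fun t : ℝ => (2 * π * t) ^ (2 * s) * exp (-(r * (2 * π * t) ^ 2)))
  simp only [fracHeatSymbol]
  rw [this, ← hd, measureReal_def, InnerProductSpace.volume_ball, ← hd]
  have e2 : ∫ t in Ioi (0 : ℝ), t ^ (d - 1) • ((2 * π * t) ^ (2 * s) *
      exp (-(r * (2 * π * t) ^ 2))) = (2 * π) ^ (2 * s) *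
      ((r * (2 * π) ^ 2) ^ (-(d / 2 + s)) * (1 / 2) * Gamma (s + d / 2)) := by
    have h := integral_rpow_mul_exp_neg_mul_rpow (p := 2) (q := d - 1 + 2 * s)
      (b := r * (2 * π) ^ 2) (by norm_num) (by linarith) (by positivity)
    rw [show -((d : ℝ) - 1 + 2 * s + 1) / 2 = -(d / 2 + s) by ring,
      show ((d : ℝ) - 1 + 2 * s + 1) / 2 = s + d / 2 by ring] at h
    rw [← h, ← integral_const_mul]
    refine setIntegral_congr_fun measurableSet_Ioi fun t (ht : 0 < t) => ?_
    simp only [smul_eq_mul]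
    rw [rpow_add ht, show ((d : ℝ) - 1) = ((d - 1 : ℕ) : ℝ) by
      rw [Nat.cast_sub hd0, Nat.cast_one], rpow_natCast, mul_rpow (by positivity) ht.le, rpow_two,
      mul_pow]
    ring_nf
  rw [e2, ENNReal.toReal_mul, ENNReal.toReal_ofReal (by
      have := Gamma_pos_of_pos (show (0 : ℝ) < d / 2 + 1 by positivity)
      positivity),
    Gamma_add_one (by positivity), ENNReal.ofReal_one, one_pow, ENNReal.toReal_one, one_mul,
    mul_rpow hr.le (by positivity), ← rpow_two (2 * π), ← rpow_mul (by positivity),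
    sqrt_eq_rpow, ← rpow_natCast, ← rpow_mul hpi.le, nsmul_eq_mul, smul_eq_mul,
    show 2 * -((d : ℝ) / 2 + s) = -(2 * (d / 2)) + -(2 * s) by ring, rpow_add (by positivity),
    rpow_neg (by positivity) (2 * s), rpow_neg (by positivity) (2 * ((d : ℝ) / 2)),
    rpow_mul (by positivity) 2 ((d : ℝ) / 2), rpow_neg (by positivity) ((d : ℝ) / 2),
    show ((2 * π) ^ (2 : ℝ)) = 4 * π * π by rw [rpow_two]; ring, mul_rpow (by positivity) hpi.le,
    show 1 / 2 * (d : ℝ) = d / 2 by ring]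
  have h1 := Gamma_pos_of_pos (half_pos hdr)
  field_simp
  rw [← mul_rpow (by positivity) (by positivity)]
  ring_nf

end Subordination

/-! ### The powers `(1 + |x|²)^{-q/2}` as superpositions of Gaussians -/

section Bessel

open Set Real

/-- The weight for which `∫₀^∞ w(t) exp (-|2πξ|² / (4t)) dt` is the Fourier transform of
`(1 + |x|²)^{-q/2}` in dimension `d`. -/
noncomputable def besselWeight (d : ℕ) (q t : ℝ) : ℝ :=
  π ^ (d / 2 : ℝ) / Gamma (q / 2) *
    (t ^ ((q - d) / 2 - 1) * exp (-t))

theorem besselWeight_nonneg {d : ℕ} {q t : ℝ} (hq : (d : ℝ) < q) (ht : 0 < t) :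
    0 ≤ besselWeight d q t := by
  have hq0 : 0 < q := lt_of_le_of_lt (by positivity) hq
  have := Gamma_pos_of_pos (half_pos hq0)
  unfold besselWeight
  positivity

theorem integrableOn_besselWeight_mul_exp {d : ℕ} {q : ℝ} (hq : (d : ℝ) < q) :
    IntegrableOn (fun t : ℝ => besselWeight d q t * exp (t / 2)) (Ioi 0) := by
  have := (integrableOn_rpow_mul_exp_neg_mul (a := (q - d) / 2) (b := 1 / 2)
    (by linarith) (by norm_num)).const_mul (π ^ (d / 2 : ℝ) / Gamma (q / 2))
  refine this.congr (Filter.Eventually.of_forall fun t => ?_)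
  simp only [besselWeight, mul_assoc, ← exp_add]
  ring_nf

theorem integrableOn_besselWeight {d : ℕ} {q : ℝ} (hq : (d : ℝ) < q) :
    IntegrableOn (besselWeight d q) (Ioi 0) := by
  have := (integrableOn_rpow_mul_exp_neg_mul (a := (q - d) / 2) (b := 1)
    (by linarith) (by norm_num)).const_mul (π ^ (d / 2 : ℝ) / Gamma (q / 2))
  refine this.congr (Filter.Eventually.of_forall fun t => ?_)
  simp only [besselWeight, one_mul]

theorem integral_besselWeight_mul {d : ℕ} {q : ℝ} (hq : (d : ℝ) < q) {s : ℝ} (hs : 0 ≤ s)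
    {b : ℝ} (hb : 0 ≤ b) :
    ∫ t in Ioi (0 : ℝ), besselWeight d q t * (((4 * t)⁻¹) ^ (-(d / 2 + s : ℝ)) *
      exp (-(b * t))) = (4 * π) ^ (d / 2 : ℝ) * 4 ^ s *
        (Gamma (s + q / 2) / Gamma (q / 2)) * (1 + b) ^ (-(q / 2 + s)) := by
  have hq0 : 0 < q := lt_of_le_of_lt (by positivity) hq
  have h := integral_rpow_mul_exp_neg_mul_Ioi (a := s + q / 2) (r := 1 + b) (by positivity)
    (by positivity)
  have hpi := pi_pos
  rw [one_div, inv_rpow (by positivity), ← rpow_neg (by positivity)] at h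
  have e : ∀ t ∈ Ioi (0 : ℝ), besselWeight d q t * (((4 * t)⁻¹) ^ (-(d / 2 + s : ℝ)) *
      exp (-(b * t))) = π ^ (d / 2 : ℝ) / Gamma (q / 2) * (4 ^ (d / 2 : ℝ) * 4 ^ s) *
        (t ^ (s + q / 2 - 1) * exp (-((1 + b) * t))) := fun t (ht : 0 < t) => by
    rw [besselWeight, inv_rpow (by positivity), rpow_neg (by positivity), inv_inv,
      mul_rpow (by positivity) ht.le, ← rpow_add (by norm_num),
      show s + q / 2 - 1 = ((q - d) / 2 - 1) + (d / 2 + s) by ring, rpow_add ht _ ((d : ℝ) / 2 + s),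
      show -((1 + b) * t) = -t + -(b * t) by ring, exp_add]
    ring
  rw [setIntegral_congr_fun measurableSet_Ioi e, integral_const_mul, h,
    mul_rpow (by norm_num) hpi.le]
  ring_nf

variable {V : Type*} [NormedAddCommGroup V] [InnerProductSpace ℝ V]

/-- The Fourier transform `|2πξ|^{2s} f̂(ξ)` of `(-Δ)^s f`, where `f(x) = (1 + |x|²)^{-q/2}`. -/
noncomputable def besselSymbol (q s : ℝ) (ξ : V) : ℝ :=
  ∫ t in Ioi (0 : ℝ), besselWeight (Module.finrank ℝ V) q t * fracHeatSymbol s (4 * t)⁻¹ ξ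

theorem besselSymbol_nonneg {q : ℝ} (hq : (Module.finrank ℝ V : ℝ) < q) (s : ℝ) (ξ : V) :
    0 ≤ besselSymbol q s ξ :=
  setIntegral_nonneg measurableSet_Ioi fun _ ht =>
    mul_nonneg (besselWeight_nonneg hq ht) (fracHeatSymbol_nonneg _ _ _)

theorem besselSymbol_eq (q s : ℝ) (ξ : V) :
    besselSymbol q s ξ = (2 * π * ‖ξ‖) ^ (2 * s) * besselSymbol q 0 ξ := by
  rw [besselSymbol, besselSymbol, ← integral_const_mul]
  congr 1 with t
  simp only [fracHeatSymbol, mul_zero, rpow_zero, one_mul]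
  ring

variable [MeasurableSpace V] [BorelSpace V]

theorem measurable_besselIntegrand (q s : ℝ) : Measurable (Function.uncurry fun (ξ : V) (t : ℝ) =>
    besselWeight (Module.finrank ℝ V) q t * fracHeatSymbol s (4 * t)⁻¹ ξ) := by
  simp only [besselWeight, fracHeatSymbol, Function.uncurry_def]
  fun_prop

theorem measurable_besselSymbol (q s : ℝ) : Measurable (besselSymbol q s : V → ℝ) :=
  ((measurable_besselIntegrand (V := V) q s).stronglyMeasurable.integral_prod_right').measurable

theorem integrableOn_besselIntegrand {q : ℝ} (hq : (Module.finrank ℝ V : ℝ) < q) (s : ℝ) (ξ : V) :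
    IntegrableOn (fun t => besselWeight (Module.finrank ℝ V) q t * fracHeatSymbol s (4 * t)⁻¹ ξ) (Ioi 0) := by
  refine Integrable.mono' ((integrableOn_besselWeight hq).mul_const
    ((2 * π * ‖ξ‖) ^ (2 * s)))
    ((measurable_besselIntegrand (V := V) q s).of_uncurry_left (x := ξ)).aestronglyMeasurable ?_
  filter_upwards [ae_restrict_mem measurableSet_Ioi] with t (ht : 0 < t)
  rw [norm_of_nonneg (mul_nonneg (besselWeight_nonneg hq ht) (fracHeatSymbol_nonneg _ _ _)),
    fracHeatSymbol]
  refine mul_le_mul_of_nonneg_left ?_ (besselWeight_nonneg hq ht)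
  refine mul_le_of_le_one_right (by positivity) (exp_le_one_iff.mpr ?_)
  simp only [Left.neg_nonpos_iff]
  positivity

/-- The Fourier transform of `(1 + |x|²)^{-q/2}` decays rapidly. It is bounded near `0` because `q`
exceeds the dimension. -/
theorem exists_besselSymbol_zero_le {q : ℝ} (hq : (Module.finrank ℝ V : ℝ) < q) {M : ℝ}
    (hM : 0 ≤ M) : ∃ C : ℝ, ∀ ξ : V, besselSymbol q 0 ξ ≤ C * (1 + ‖ξ‖ ^ 2) ^ (-M) := by
  obtain ⟨C, hC, h⟩ := exists_one_add_rpow_le_exp M (c := π ^ 2) (by positivity)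
  obtain ⟨D, hD, h'⟩ := exists_one_add_rpow_le_exp M (c := 1 / 2) (by norm_num)
  refine ⟨∫ t in Ioi (0 : ℝ), besselWeight (Module.finrank ℝ V) q t * exp (t / 2) * (D * C), fun ξ => ?_⟩
  rw [besselSymbol, ← integral_mul_const]
  refine setIntegral_mono_on (integrableOn_besselIntegrand hq 0 ξ)
    (((integrableOn_besselWeight_mul_exp hq).mul_const _).mul_const _) measurableSet_Ioi
    fun t (ht : 0 < t) => ?_
  rw [mul_assoc, mul_assoc]
  refine mul_le_mul_of_nonneg_left ?_ (besselWeight_nonneg hq ht)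
  rw [rpow_neg (by positivity), ← mul_assoc, ← div_eq_mul_inv, le_div_iff₀ (by positivity)]
  have h1 : (1 + ‖ξ‖ ^ 2) ≤ (1 + t) * (1 + ‖ξ‖ ^ 2 / t) := by
    have : t * (‖ξ‖ ^ 2 / t) = ‖ξ‖ ^ 2 := by field_simp
    have h3 : 0 ≤ ‖ξ‖ ^ 2 / t := by positivity
    nlinarith
  have h2 : (1 + ‖ξ‖ ^ 2) ^ M ≤ (D * exp (1 / 2 * t)) * (C * exp (π ^ 2 * (‖ξ‖ ^ 2 / t))) := by
    refine (rpow_le_rpow (by positivity) h1 hM).trans ?_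
    rw [mul_rpow (by positivity) (by positivity)]
    exact mul_le_mul (h' t ht.le) (h _ (by positivity)) (by positivity) (by positivity)
  have e : fracHeatSymbol 0 (4 * t)⁻¹ ξ = (exp (π ^ 2 * (‖ξ‖ ^ 2 / t)))⁻¹ := by
    rw [fracHeatSymbol, mul_zero, rpow_zero, one_mul, ← exp_neg]
    congr 1
    field_simp
    norm_num
  rw [e]
  calc _ ≤ (exp (π ^ 2 * (‖ξ‖ ^ 2 / t)))⁻¹ *
        ((D * exp (1 / 2 * t)) * (C * exp (π ^ 2 * (‖ξ‖ ^ 2 / t)))) := by gcongr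
    _ = _ := by
      have := exp_pos (π ^ 2 * (‖ξ‖ ^ 2 / t))
      rw [show 1 / 2 * t = t / 2 by ring]
      field_simp

variable [FiniteDimensional ℝ V]

theorem integrable_and_memLp_two_of_norm_le {h : V → ℂ} (hm : AEStronglyMeasurable h) {C p : ℝ}
    (hp : (Module.finrank ℝ V / 2 : ℝ) < p) (hb : ∀ ξ, ‖h ξ‖ ≤ C * (1 + ‖ξ‖ ^ 2) ^ (-p)) :
    Integrable h ∧ MemLp h 2 := by
  have hp0 : 0 < p := lt_of_le_of_lt (by positivity) hp
  have hi : Integrable fun ξ : V => (1 + ‖ξ‖ ^ 2) ^ (-p) := by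
    have := integrable_rpow_neg_one_add_norm_sq (E := V) (μ := volume) (r := 2 * p) (by linarith)
    convert! this using 3
    ring
  have hC : 0 ≤ C := by
    have := (norm_nonneg _).trans (hb 0)
    simpa using this
  refine ⟨(hi.const_mul C).mono' hm (Filter.Eventually.of_forall hb), ?_⟩
  rw [memLp_two_iff_integrable_sq_norm hm]
  refine (hi.const_mul (C ^ 2)).mono' (hm.norm.pow 2) (Filter.Eventually.of_forall fun ξ => ?_)
  rw [norm_of_nonneg (by positivity)]
  have h1 : (1 + ‖ξ‖ ^ 2) ^ (-p) ≤ 1 :=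
    rpow_le_one_of_one_le_of_nonpos (by nlinarith [sq_nonneg ‖ξ‖]) (by linarith)
  calc ‖h ξ‖ ^ 2 ≤ (C * (1 + ‖ξ‖ ^ 2) ^ (-p)) ^ 2 := by gcongr; exact hb ξ
    _ = C ^ 2 * ((1 + ‖ξ‖ ^ 2) ^ (-p) * (1 + ‖ξ‖ ^ 2) ^ (-p)) := by ring
    _ ≤ _ := by
      gcongr
      exact mul_le_of_le_one_right (by positivity) h1

theorem ofReal_re_fourierInv_of_even {S : V → ℝ} (hS : ∀ ξ, S (-ξ) = S ξ) (x : V) :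
    (((𝓕⁻ (fun ξ => (S ξ : ℂ)) x).re : ℝ) : ℂ) = 𝓕⁻ (fun ξ => (S ξ : ℂ)) x := by
  rw [← Complex.conj_eq_iff_re, Real.fourierInv_eq', ← integral_conj,
    ← integral_neg_eq_self]
  congr 1 with ξ
  simp [hS, ← Complex.exp_conj, Complex.conj_ofNat]

/-- Multiples of the Fourier transform of `(1 + |x|²)^{-q/2}` by functions of polynomial growth are in
`L¹ ∩ L²`. -/
theorem integrable_and_memLp_besselSymbol {q : ℝ} (hq : (Module.finrank ℝ V : ℝ) < q)
    {m : V → ℝ} (hm : Continuous m) {C s : ℝ} (hs : 0 ≤ s)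
    (hb : ∀ ξ, |m ξ| ≤ C * (1 + ‖ξ‖ ^ 2) ^ s) :
    Integrable (fun ξ => ((m ξ * besselSymbol q 0 ξ : ℝ) : ℂ)) ∧
      MemLp (fun ξ => ((m ξ * besselSymbol q 0 ξ : ℝ) : ℂ)) 2 := by
  obtain ⟨D, hD⟩ := exists_besselSymbol_zero_le (V := V) hq
    (M := s + (Module.finrank ℝ V / 2 + 1)) (by positivity)
  refine integrable_and_memLp_two_of_norm_le (C := C * D) (p := Module.finrank ℝ V / 2 + 1)
    ?_ (by linarith) fun ξ => ?_
  · exact (Complex.measurable_ofReal.comp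
      (hm.measurable.mul (measurable_besselSymbol q 0))).aestronglyMeasurable
  · rw [Complex.norm_real, norm_mul, norm_eq_abs, norm_of_nonneg (besselSymbol_nonneg hq 0 ξ)]
    calc _ ≤ (C * (1 + ‖ξ‖ ^ 2) ^ s) *
          (D * (1 + ‖ξ‖ ^ 2) ^ (-(s + (Module.finrank ℝ V / 2 + 1) : ℝ))) :=
          mul_le_mul (hb ξ) (hD ξ) (besselSymbol_nonneg hq 0 ξ) ((abs_nonneg _).trans (hb ξ))
      _ = C * D * ((1 + ‖ξ‖ ^ 2) ^ s * (1 + ‖ξ‖ ^ 2) ^ (-(s + (Module.finrank ℝ V / 2 + 1) : ℝ))) := by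
        ring
      _ = _ := by
        rw [← rpow_add (by positivity)]
        congr 2
        ring

theorem integrable_and_memLp_two_besselSymbol {q : ℝ} (hq : (Module.finrank ℝ V : ℝ) < q) {s : ℝ}
    (hs : 0 ≤ s) : Integrable (fun ξ : V => (besselSymbol q s ξ : ℂ)) ∧
      MemLp (fun ξ : V => (besselSymbol q s ξ : ℂ)) 2 := by
  simp_rw [besselSymbol_eq q s]
  refine integrable_and_memLp_besselSymbol hq ?_ hs (C := (2 * π) ^ (2 * s)) fun ξ => ?_
  · exact (by fun_prop : Continuous fun ξ : V => 2 * π * ‖ξ‖).rpow_const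
      fun _ => Or.inr (by positivity)
  · rw [abs_of_nonneg (by positivity), mul_rpow (by positivity) (norm_nonneg _),
      rpow_mul (norm_nonneg ξ), rpow_two]
    gcongr
    linarith

/-- `(-Δ)^s (1 + |x|²)^{-q/2}` as a superposition of the kernels of `(-Δ)^s e^{rΔ}`, `r = 1/(4t)`. -/
theorem fourierInv_besselSymbol {q : ℝ} (hq : (Module.finrank ℝ V : ℝ) < q) {s : ℝ}
    (hs : 0 ≤ s) (x : V) : 𝓕⁻ (fun ξ : V => (besselSymbol q s ξ : ℂ)) x =
      ∫ t in Ioi (0 : ℝ), (besselWeight (Module.finrank ℝ V) q t : ℂ) * fracHeatKernel s (4 * t)⁻¹ x := by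
  have h := fourierInv_integral_swap (ν := volume.restrict (Ioi (0 : ℝ)))
    (measurable_besselIntegrand (V := V) q s).aestronglyMeasurable
    (fun ξ => by
      filter_upwards [ae_restrict_mem measurableSet_Ioi] with t (ht : 0 < t)
      exact mul_nonneg (besselWeight_nonneg hq ht) (fracHeatSymbol_nonneg _ _ _))
    (Filter.Eventually.of_forall fun ξ => integrableOn_besselIntegrand hq s ξ)
    (by
      have : Integrable (besselSymbol q s : V → ℝ) := by
        simpa using! (integrable_and_memLp_two_besselSymbol (V := V) hq hs).1.re
      exact this) x
  simp_rw [fourierInv_const_mul_ofReal] at h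
  exact h

/-- Fourier inversion for `(1 + |x|²)^{-q/2}`, from the Gamma integral of `e^{-t(1 + |x|²)}`. -/
theorem fourierInv_besselSymbol_zero {q : ℝ} (hq : (Module.finrank ℝ V : ℝ) < q) (x : V) :
    𝓕⁻ (fun ξ : V => (besselSymbol q 0 ξ : ℂ)) x = (((1 + ‖x‖ ^ 2) ^ (-q / 2) : ℝ) : ℂ) := by
  have hq0 : 0 < q := lt_of_le_of_lt (by positivity) hq
  have h := integral_besselWeight_mul hq le_rfl (sq_nonneg ‖x‖)
  have hG := Gamma_pos_of_pos (half_pos hq0)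
  rw [fourierInv_besselSymbol hq le_rfl]
  have e : ∀ t ∈ Ioi (0 : ℝ), (besselWeight (Module.finrank ℝ V) q t : ℂ) * fracHeatKernel 0 (4 * t)⁻¹ x =
      (((4 * π) ^ (-(Module.finrank ℝ V / 2 : ℝ)) * (besselWeight (Module.finrank ℝ V) q t *
        (((4 * t)⁻¹) ^ (-(Module.finrank ℝ V / 2 + 0 : ℝ)) * exp (-(‖x‖ ^ 2 * t)))) : ℝ) : ℂ) :=
    fun t (ht : 0 < t) => by
      rw [fracHeatKernel_zero (by positivity), ← Complex.ofReal_mul, add_zero,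
        show -(‖x‖ ^ 2 / (4 * t)⁻¹) / 4 = -(‖x‖ ^ 2 * t) by field_simp]
      congr 1
      ring
  rw [setIntegral_congr_fun measurableSet_Ioi e]
  rw [integral_complex_ofReal, integral_const_mul, h, rpow_neg (by positivity)]
  have : 0 < (4 * π) ^ (Module.finrank ℝ V / 2 : ℝ) := by positivity
  congr 1
  rw [rpow_zero, zero_add, add_zero, div_self hG.ne', neg_div]
  field_simp

theorem fourierInv_besselSymbol_apply_zero [Nontrivial V] {q : ℝ}
    (hq : (Module.finrank ℝ V : ℝ) < q) {s : ℝ} (hs : 0 ≤ s) :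
    𝓕⁻ (fun ξ : V => (besselSymbol q s ξ : ℂ)) 0 =
      ((4 ^ s * (Gamma (s + Module.finrank ℝ V / 2) / Gamma (Module.finrank ℝ V / 2)) *
        (Gamma (s + q / 2) / Gamma (q / 2)) : ℝ) : ℂ) := by
  have h := integral_besselWeight_mul hq hs le_rfl
  rw [fourierInv_besselSymbol hq hs]
  have e : ∀ t ∈ Ioi (0 : ℝ), (besselWeight (Module.finrank ℝ V) q t : ℂ) * fracHeatKernel s (4 * t)⁻¹ (0 : V) =
      (((4 * π) ^ (-(Module.finrank ℝ V / 2 : ℝ)) *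
      (Gamma (s + Module.finrank ℝ V / 2) / Gamma (Module.finrank ℝ V / 2)) * (besselWeight (Module.finrank ℝ V) q t *
        (((4 * t)⁻¹) ^ (-(Module.finrank ℝ V / 2 + s : ℝ)) * exp (-(0 * t)))) : ℝ) : ℂ) :=
    fun t (ht : 0 < t) => by
      rw [fracHeatKernel_apply_zero hs (by positivity), ← Complex.ofReal_mul, zero_mul, neg_zero,
        exp_zero, mul_one]
      congr 1
      ring
  rw [setIntegral_congr_fun measurableSet_Ioi e]
  rw [integral_complex_ofReal, integral_const_mul, h, rpow_neg (by positivity), add_zero, one_rpow]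
  have : 0 < (4 * π) ^ (Module.finrank ℝ V / 2 : ℝ) := by positivity
  congr 1
  field_simp

/-- Decay of `(-Δ)^s (1 + |x|²)^{-q/2}` for arbitrary `s > 0`, with the exponent `d + 2s` of the kernels. -/
theorem exists_norm_fourierInv_besselSymbol_le {q : ℝ} (hq : (Module.finrank ℝ V : ℝ) < q) {s : ℝ}
    (hs : 0 < s) : ∃ C : ℝ, 0 ≤ C ∧ ∀ x : V, ‖𝓕⁻ (fun ξ : V => (besselSymbol q s ξ : ℂ)) x‖ ≤
      C * (1 + ‖x‖ ^ 2) ^ (-(Module.finrank ℝ V / 2 + s : ℝ)) := by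
  set p : ℝ := Module.finrank ℝ V / 2 + s with hp
  have hp0 : 0 < p := by positivity
  obtain ⟨C, hC, h⟩ := exists_norm_fracHeatKernel_le (V := V) hs
  obtain ⟨D, hD, h'⟩ := exists_one_add_rpow_le_exp p (c := 1 / 8) (by norm_num)
  refine ⟨∫ t in Ioi (0 : ℝ), besselWeight (Module.finrank ℝ V) q t * exp (t / 2) * (C * D),
    setIntegral_nonneg measurableSet_Ioi fun t ht => ?_, fun x => ?_⟩
  · have := besselWeight_nonneg hq ht
    positivity
  rw [fourierInv_besselSymbol hq hs.le, ← integral_mul_const]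
  refine norm_integral_le_of_norm_le
    (((integrableOn_besselWeight_mul_exp hq).mul_const _).mul_const _) ?_
  filter_upwards [ae_restrict_mem measurableSet_Ioi] with t (ht : 0 < t)
  have hw := besselWeight_nonneg hq ht
  rw [norm_mul, Complex.norm_real, norm_of_nonneg hw, mul_assoc, mul_assoc]
  refine mul_le_mul_of_nonneg_left ((h _ (by positivity) x).trans ?_) hw
  -- the loss `(1 + 4t)^p` is absorbed by half of the weight's factor `e^{-t}`
  have h1 : (1 + ‖x‖ ^ 2) / (1 + 4 * t) ≤ (4 * t)⁻¹ + ‖x‖ ^ 2 := by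
    rw [div_le_iff₀ (by positivity)]
    have : (4 * t)⁻¹ * (4 * t) = 1 := inv_mul_cancel₀ (by positivity)
    have : 0 ≤ (4 * t)⁻¹ := by positivity
    nlinarith [mul_nonneg (sq_nonneg ‖x‖) ht.le]
  calc C * ((4 * t)⁻¹ + ‖x‖ ^ 2) ^ (-p) ≤ C * ((1 + ‖x‖ ^ 2) / (1 + 4 * t)) ^ (-p) := by
        exact mul_le_mul_of_nonneg_left
          (rpow_le_rpow_of_nonpos (by positivity) h1 (by linarith)) hC.le
    _ = C * ((1 + 4 * t) ^ p * (1 + ‖x‖ ^ 2) ^ (-p)) := by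
        rw [div_rpow (by positivity) (by positivity), rpow_neg (by positivity : 0 ≤ 1 + 4 * t),
          div_inv_eq_mul, mul_comm ((1 + ‖x‖ ^ 2) ^ (-p))]
    _ ≤ C * (D * exp (1 / 8 * (4 * t)) * (1 + ‖x‖ ^ 2) ^ (-p)) := by
        gcongr
        exact h' _ (by positivity)
    _ = _ := by
        rw [show 1 / 8 * (4 * t) = t / 2 by ring]
        ring

/-- Decay of `(-Δ)^k (1 + |x|²)^{-q/2}` for integer `k`. The kernels have Gaussian decay, and the factor
`e^{-t} e^{-t|x|²/2} ≤ e^{-t(1 + |x|²)/2}` under the Gamma integral gives the exponent `q + 2k`. -/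
theorem exists_norm_fourierInv_besselSymbol_nat_le {q : ℝ} (hq : (Module.finrank ℝ V : ℝ) < q)
    (k : ℕ) : ∃ C : ℝ, 0 ≤ C ∧ ∀ x : V, ‖𝓕⁻ (fun ξ : V => (besselSymbol q k ξ : ℂ)) x‖ ≤
      C * (1 + ‖x‖ ^ 2) ^ (-(q / 2 + k : ℝ)) := by
  have hq0 : 0 < q := lt_of_le_of_lt (by positivity) hq
  have hG := Gamma_pos_of_pos (half_pos hq0)
  have hG' : 0 < Gamma (k + q / 2) := Gamma_pos_of_pos (by positivity)
  set d : ℝ := (Module.finrank ℝ V : ℝ) with hd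
  obtain ⟨C, hC, h⟩ := exists_norm_fracHeatKernel_nat_le (V := V) k
  refine ⟨π ^ (d / 2) / Gamma (q / 2) * (C * 4 ^ (d / 2 + k)) *
    (2 ^ (q / 2 + k) * Gamma (k + q / 2)), by positivity, fun x => ?_⟩
  have hi := integral_rpow_mul_exp_neg_mul_Ioi (a := k + q / 2) (r := (1 + ‖x‖ ^ 2) / 2)
    (by positivity) (by positivity)
  rw [one_div, inv_div, div_rpow (by norm_num) (by positivity)] at hi
  rw [fourierInv_besselSymbol hq (Nat.cast_nonneg k)]
  calc _ ≤ ∫ t in Ioi (0 : ℝ), π ^ (d / 2) / Gamma (q / 2) * (C * 4 ^ (d / 2 + k)) *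
        (t ^ (k + q / 2 - 1) * exp (-((1 + ‖x‖ ^ 2) / 2 * t))) := by
        refine norm_integral_le_of_norm_le ((integrableOn_rpow_mul_exp_neg_mul (by positivity)
          (by positivity)).const_mul _) ?_
        filter_upwards [ae_restrict_mem measurableSet_Ioi] with t (ht : 0 < t)
        have hw := besselWeight_nonneg hq ht
        rw [norm_mul, Complex.norm_real, norm_of_nonneg hw]
        refine (mul_le_mul_of_nonneg_left (h _ (by positivity) x) hw).trans ?_
        rw [← hd, inv_rpow (by positivity), rpow_neg (by positivity), inv_inv,
          mul_rpow (by norm_num) ht.le, besselWeight, ← hd,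
          show (k + q / 2 - 1 : ℝ) = ((q - d) / 2 - 1) + (d / 2 + k) by ring, rpow_add ht _ (d / 2 + k),
          show -(‖x‖ ^ 2 / (4 * t)⁻¹) / 8 = -(‖x‖ ^ 2 * t / 2) by field_simp; ring]
        have he : exp (-t) * exp (-(‖x‖ ^ 2 * t / 2)) ≤ exp (-((1 + ‖x‖ ^ 2) / 2 * t)) := by
          rw [← exp_add]
          exact exp_le_exp.mpr (by linarith)
        calc _ = π ^ (d / 2) / Gamma (q / 2) * (C * 4 ^ (d / 2 + k)) *
              (t ^ ((q - d) / 2 - 1) * t ^ (d / 2 + k)) *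
              (exp (-t) * exp (-(‖x‖ ^ 2 * t / 2))) := by ring
          _ ≤ _ * exp (-((1 + ‖x‖ ^ 2) / 2 * t)) := by gcongr
          _ = _ := by ring
    _ = _ := by
        rw [integral_const_mul, hi, add_comm (q / 2), rpow_neg (by positivity)]
        ring

end Bessel

/-! ### The fractional Laplacian of the Japanese bracket -/

section Bracket

open Real

variable {n : ℕ}

theorem japaneseBracket_rpow (x : EuclideanSpace ℝ (Fin n)) (p : ℝ) :
    japaneseBracket x ^ p = (1 + ‖x‖ ^ 2) ^ (p / 2) := by
  rw [japaneseBracket, sqrt_eq_rpow, ← rpow_mul (by positivity)]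
  ring_nf

/-- A criterion for membership in `H^s` in terms of a representative of the Fourier transform. -/
theorem mem_sobolevH_of_fourier_eq {s : ℝ} (hs : 0 ≤ s) {f : L2Space n}
    {F : EuclideanSpace ℝ (Fin n) → ℂ} (hF : MemLp F 2) (hf : 𝓕 f = hF.toLp F)
    (hsF : MemLp (fun ξ => (((1 + ‖ξ‖ ^ 2) ^ (s / 2) : ℝ) : ℂ) * F ξ) 2) : f ∈ SobolevH n s := by
  refine TemperedDistribution.memSobolev_iff_exists_smulLeftCLM_fourier.mpr ⟨hsF.toLp _, ?_⟩
  rw [Lp.fourier_toTemperedDistribution_eq, hf]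
  set v : EuclideanSpace ℝ (Fin n) → ℂ := fun ξ => (((1 + ‖ξ‖ ^ 2) ^ (-s / 2) : ℝ) : ℂ) with hv
  have hvg : v.HasTemperateGrowth := by rw [hv]; fun_prop
  have hvL : MemLp v ⊤ (volume : Measure (EuclideanSpace ℝ (Fin n))) := by
    refine memLp_top_of_bound hvg.1.continuous.aestronglyMeasurable 1
      (Filter.Eventually.of_forall fun ξ => ?_)
    rw [hv, Complex.norm_real, norm_of_nonneg (by positivity)]
    exact rpow_le_one_of_one_le_of_nonpos (by nlinarith [sq_nonneg ‖ξ‖]) (by linarith)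
  have hw : ∀ ξ : EuclideanSpace ℝ (Fin n),
      (((1 + ‖ξ‖ ^ 2) ^ (s / 2) : ℝ) : ℂ) * v ξ = 1 := fun ξ => by
    rw [hv]
    beta_reduce
    rw [← Complex.ofReal_mul, ← rpow_add (by positivity), neg_div, add_neg_cancel, rpow_zero,
      Complex.ofReal_one]
  have key : hF.toLp F = (hvL.toLp v • hsF.toLp _ : L2Space n) := by
    apply Lp.ext
    filter_upwards [Lp.coeFn_lpSMul (r := 2) (hvL.toLp v) (hsF.toLp _), hvL.coeFn_toLp,
      hF.coeFn_toLp, hsF.coeFn_toLp] with ξ h1 h2 h3 h4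
    rw [h1, Pi.smul_apply', h2, h3, h4, smul_eq_mul, ← mul_assoc, mul_comm (v ξ), hw, one_mul]
  rw [key, Lp.toTemperedDistribution_smul_eq hvg,
    TemperedDistribution.smulLeftCLM_smulLeftCLM_apply hvg (by fun_prop)]
  convert! TemperedDistribution.smulLeftCLM_const 1 _ using 2
  · congr 1
    ext ξ
    exact (mul_comm _ _).trans (hw ξ)
  · simp

/-- The continuous representative of `(-Δ)^σ ⟨x⟩^{-q}` is the inverse Fourier integral of the symbol,
which is real since the symbol is even. -/
theorem isFracLaplacian_japaneseBracket {q σ : ℝ} (hq : (n : ℝ) < q) (hσ : 0 ≤ σ) :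
    IsFracLaplacian σ (fun x : EuclideanSpace ℝ (Fin n) => japaneseBracket x ^ (-q))
      (fun x => (𝓕⁻ (fun ξ : EuclideanSpace ℝ (Fin n) => (besselSymbol q σ ξ : ℂ)) x).re) := by
  have hq' : (Module.finrank ℝ (EuclideanSpace ℝ (Fin n)) : ℝ) < q := by simpa using hq
  obtain ⟨h0i, h0⟩ :=
    integrable_and_memLp_two_besselSymbol (V := EuclideanSpace ℝ (Fin n)) hq' le_rfl
  obtain ⟨hsi, hs⟩ :=
    integrable_and_memLp_two_besselSymbol (V := EuclideanSpace ℝ (Fin n)) hq' hσ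
  have hfun : (fun x : EuclideanSpace ℝ (Fin n) => ((japaneseBracket x ^ (-q) : ℝ) : ℂ)) =
      𝓕⁻ (fun ξ : EuclideanSpace ℝ (Fin n) => (besselSymbol q 0 ξ : ℂ)) := by
    ext x
    rw [fourierInv_besselSymbol_zero hq', japaneseBracket_rpow]
  have hae := Lp.fourierInv_toLp_ae_eq h0 h0i
  rw [← hfun] at hae
  have hf : MemLp (fun x : EuclideanSpace ℝ (Fin n) => ((japaneseBracket x ^ (-q) : ℝ) : ℂ)) 2 :=
    (memLp_congr_ae hae).mp (Lp.memLp _)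
  have hfL : hf.toLp _ = 𝓕⁻ (h0.toLp _ : L2Space n) := by
    apply Lp.ext
    exact hf.coeFn_toLp.trans hae.symm
  have hFf : 𝓕 (hf.toLp _ : L2Space n) = h0.toLp _ := by
    rw [hfL, FourierTransform.fourier_fourierInv_eq]
  have hmem : hf.toLp _ ∈ SobolevH n (2 * σ) := by
    refine mem_sobolevH_of_fourier_eq (by linarith) h0 hFf ?_
    have := (integrable_and_memLp_besselSymbol hq'
      (m := fun ξ : EuclideanSpace ℝ (Fin n) => (1 + ‖ξ‖ ^ 2) ^ (2 * σ / 2)) (C := 1) (s := σ)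
      ?_ hσ fun ξ => ?_).2
    · simpa only [Complex.ofReal_mul] using this
    · exact (by fun_prop : Continuous fun ξ : EuclideanSpace ℝ (Fin n) => 1 + ‖ξ‖ ^ 2).rpow_const
        fun ξ => Or.inl (by positivity)
    · rw [abs_of_nonneg (by positivity), one_mul, mul_div_cancel_left₀ _ two_ne_zero]
  have hreal := ofReal_re_fourierInv_of_even (S := besselSymbol (V := EuclideanSpace ℝ (Fin n)) q σ)
    (fun ξ => by simp only [besselSymbol, fracHeatSymbol, norm_neg])
  refine ⟨by linarith, hf, hmem, ?_, ?_⟩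
  · exact Complex.continuous_re.comp (continuous_fourierInv_of_integrable hsi)
  · have hL : (SobolevH.memLp_symbol_mul (by linarith : 0 ≤ 2 * σ) hmem).toLp _ = hs.toLp _ := by
      rw [MemLp.toLp_eq_toLp_iff, hFf]
      filter_upwards [h0.coeFn_toLp] with ξ hξ
      rw [hξ, besselSymbol_eq q σ, Complex.ofReal_mul]
    rw [fracLaplacian, hL]
    filter_upwards [Lp.fourierInv_toLp_ae_eq hs hsi] with x hx
    rw [hx, hreal]

end Bracket

theorem corollary3p2 (n : ℕ) (hn : 1 ≤ n) (q σ : ℝ) (hq : (n : ℝ) < q) (hσ : 0 < σ) :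
    ∃ g : EuclideanSpace ℝ (Fin n) → ℝ,
      IsFracLaplacian σ (fun x => japaneseBracket x ^ (-q)) g ∧
      (∃ C : ℝ, ∀ x, |g x| ≤ C * japaneseBracket x ^ (-decayExponent n q σ)) ∧
      (∀ C : ℝ, (∀ x, |g x| ≤ C * japaneseBracket x ^ (-decayExponent n q σ)) → g 0 ≤ C) ∧
      g 0 = 2 ^ (2 * σ) * (Real.Gamma (σ + n / 2) / Real.Gamma (n / 2)) *
        (Real.Gamma (σ + q / 2) / Real.Gamma (q / 2)) := by
  have hq' : (Module.finrank ℝ (EuclideanSpace ℝ (Fin n)) : ℝ) < q := by simpa using hq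
  have : NeZero n := ⟨by omega⟩
  refine ⟨_, isFracLaplacian_japaneseBracket hq hσ.le, ?_, fun C hC => ?_, ?_⟩
  · by_cases h : σ = (⌊σ⌋ : ℝ)
    · obtain ⟨k, hk⟩ := Int.eq_ofNat_of_zero_le (Int.floor_nonneg.mpr hσ.le)
      have hσk : σ = k := by rw [h, hk, Int.cast_natCast]
      obtain ⟨C, -, hC⟩ := exists_norm_fourierInv_besselSymbol_nat_le hq' k
      refine ⟨C, fun x => (Complex.abs_re_le_norm _).trans ?_⟩
      rw [decayExponent, if_pos h, japaneseBracket_rpow, hσk]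
      convert! hC x using 3
      ring
    · obtain ⟨C, hC0, hC⟩ := exists_norm_fourierInv_besselSymbol_le hq' hσ
      -- the exponent `n + 2σ` obtained is at least `n + 2(σ - [σ])`
      refine ⟨C, fun x => (Complex.abs_re_le_norm _).trans ((hC x).trans ?_)⟩
      rw [decayExponent, if_neg h, japaneseBracket_rpow, finrank_euclideanSpace_fin]
      have h0 : (0 : ℝ) ≤ ⌊σ⌋ := by exact_mod_cast Int.floor_nonneg.mpr hσ.le
      exact mul_le_mul_of_nonneg_left (Real.rpow_le_rpow_of_exponent_le
        (by nlinarith [sq_nonneg ‖x‖]) (by linarith)) hC0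
  · have := (le_abs_self _).trans (hC 0)
    simpa [japaneseBracket_rpow] using this
  · beta_reduce
    rw [fourierInv_besselSymbol_apply_zero hq' hσ.le, Complex.ofReal_re,
      finrank_euclideanSpace_fin, Real.rpow_mul (by norm_num)]
    norm_num
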